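/- Let $\mathbb F_q$ be a finite field of odd characteristic. For $n\ge 0$ let $[\pm n]=\{\pm1,\dots,\pm n\}$ be ordered by $1\prec\cdots\prec n\prec -n\prec\cdots\prec -1$; rows and columns of $2n\times 2n$ matrices are indexed by $[\pm n]$ in this order. Let $U_m(q)$ be the group of $m\times m$ unipotent upper triangular matrices over $\mathbb F_q$, and let $$U^D_{2n}(q)=\left\{\begin{pmatrix}P&PQ\\0&JP^{-t}J\end{pmatrix}: P\in U_n(q),\ Q\in M_n(\mathbb F_q),\ JQ^tJ=-Q\right\},$$ where $J$ is the $n\times n$ matrix with ones on the antidiagonal and zeros elsewhere. A $D_{2n}(q)$-partition $\lambda$ is a finite set of labelled arcs $(i,j,a)$ with $i\prec j$ in $[\pm n]$, $j\ne -i$, $a\in\mathbb F_q\setminus\{0\}$, at most one label for each pair $(i,j)$, such that (a) $(i,j,a)\in\lambda$ implies $(-j,-i,-a)\in\lambda$, and (b) if $(i,j,a)\in\lambda$ and $i\prec k\prec j$, then $(i,k,b)\notin\lambda$ and $(k,j,b)\notin\lambda$ for all $b$. Put $y_\lambda=\sum_{(i,j,a)\in\lambda}a\,e_{i,j}$. The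 superclass of $\lambda$ is $K_\lambda=U^D_{2n}(q)\cap\bigl(I_{2n}+U_{2n}(q)\,y_\lambda\,U_{2n}(q)\bigr)$, and $\kappa_\lambda:U^D_{2n}(q)\to\mathbb C$ is its characteristic function. Let $\mathbf{SC}^D_{2n}$ be the space of functions $U^D_{2n}(q)\to\mathbb C$ that are constant on every superclass, and $\mathbf{SC}^D=\bigoplus_{n\ge0}\mathbf{SC}^D_{2n}$. For $A\subseteq[n]$ let $A^c=[n]\setminus A$ and $\pm A=A\cup -A$, and let $\mathrm{st}_A:\pm A\to[\pm|A|]$ be the order-preserving bijection. For $J=(A\,|\,A^c)$ let $U^D_J$ be the set of $x\in U^D_{2n}(q)$ such that $x_{ij}\neq0$ only if $i,j$ both lie in $\pm A$ or both lie in $\pm A^c$. Reordering rows and columns by $\mathrm{st}_A$ and $\mathrm{st}_{A^c}$ gives a bijection $\mathrm{st}_J:U_J^D\to U^D_{2|A|}(q)\times U^D_{2|A^c|}(q)$. Let $$\mathrm{Res}_J:\mathbf{SC}^D_{2n}\to\mathbf{SC}^D_{2|A|}\otimes\mathbf{SC}^D_{2|A^c|},\qquad \mathrm{Res}_J(\chi)(u)=\chi(\mathrm{st}_J^{-1}(u)),$$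 where a tensor $\alpha\otimes\beta$ is identified with the function $(u,v)\mapsto\alpha(u)\beta(v)$. Let $\Delta:\mathbf{SC}^D\to\mathbf{SC}^D\otimes\mathbf{SC}^D$ be the linear map with $\Delta(\chi)=\sum_{J}\mathrm{Res}_J(\chi)$ for $\chi\in\mathbf{SC}^D_{2n}$, summed over all $J=(A\,|\,A^c)$ with $A\subseteq[n]$ (including $A=\emptyset$ and $A=[n]$). For a $D_{2n}(q)$-partition $\lambda$ let $\lambda|_A$ be the set of arcs of $\lambda$ with both ends in $\pm A$, and let $\mathrm{st}_A(\lambda|_A)$ be the $D_{2|A|}(q)$-partition obtained by relabelling the ends of its arcs by $\mathrm{st}_A$. Write $\lambda=\lambda|_A\sqcup\lambda|_{A^c}$ if every arc of $\lambda$ lies in $\lambda|_A$ or in $\lambda|_{A^c}$. **Proposition.** For every $n\ge 0$ and every $D_{2n}(q)$-partition $\lambda$, $$\Delta(\kappa_\lambda)=\sum_{\substack{A\subseteq[n]\\ \lambda=\lambda|_A\sqcup\lambda|_{A^c}}}\kappa_{\mathrm{st}_A(\lambda|_A)}\otimes\kappa_{\mathrm{st}_{A^c}(\lambda|_{A^c})}.$$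 -/

import Mathlib

open scoped TensorProduct DirectSum

noncomputable section

namespace TypeD

/-! The ground set `[±n]` with the total order `1 ≺ ⋯ ≺ n ≺ -n ≺ ⋯ ≺ -1`. -/

/-- The ordered set `[±n]`: a copy of `Fin n` (the elements `1 ≺ ⋯ ≺ n`) followed by a reversed
copy of `Fin n` (the elements `-n ≺ ⋯ ≺ -1`). -/
abbrev PM (n : ℕ) : Type := Fin n ⊕ₗ (Fin n)ᵒᵈ

/-- The map `i ↦ |i|` from `[±n]` to `[n]`. -/
def absv {n : ℕ} (s : PM n) : Fin n :=
  Sum.elim id OrderDual.ofDual (ofLex s)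

/-- The map `i ↦ -i` on `[±n]`. -/
def opp {n : ℕ} (s : PM n) : PM n :=
  toLex (Sum.elim (fun i => Sum.inr (OrderDual.toDual i)) (fun i => Sum.inl (OrderDual.ofDual i))
    (ofLex s))

/-- The block (left or right) and the position inside it of an element of `[±n]`: `i` sits at
position `i` of the first block, and `-i` at position `n + 1 - i` of the second one. -/
def place {n : ℕ} (s : PM n) : Fin n ⊕ Fin n :=
  Sum.map id (fun i => Fin.rev (OrderDual.ofDual i)) (ofLex s)

/-- The inverse `[±|A|] → ±A ⊆ [±n]` of the standardization map `st_A`: the order preserving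
bijection from `[|A|]` onto `A`, applied to absolute values. -/
def unst {n : ℕ} (A : Finset (Fin n)) (s : PM A.card) : PM n :=
  toLex (Sum.map (A.orderEmbOfFin rfl)
    (fun i => OrderDual.toDual (A.orderEmbOfFin rfl (OrderDual.ofDual i))) (ofLex s))

/-! The groups. -/

/-- The group of unipotent upper triangular matrices. -/
def Uni (ι F : Type*) [LinearOrder ι] [Field F] : Set (Matrix ι ι F) :=
  {g | (∀ i, g i i = 1) ∧ ∀ i j, j < i → g i j = 0}

/-- The matrix with ones on the antidiagonal and zeros elsewhere. -/
def antidiag (n : ℕ) (F : Type*) [Field F] : Matrix (Fin n) (Fin n) F :=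
  Matrix.of fun i j => if j = Fin.rev i then 1 else 0

/-- The even orthogonal unipotent upper triangular matrices, i.e. the matrices
`(P, PQ; 0, J P⁻ᵗ J)` with `P` unipotent upper triangular and `J Qᵗ J = -Q`. The rows and columns
are labelled by `[±n]` in increasing order. -/
def UD (n : ℕ) (F : Type*) [Field F] : Set (Matrix (PM n) (PM n) F) :=
  {x | ∃ P ∈ Uni (Fin n) F, ∃ Q : Matrix (Fin n) (Fin n) F,
    antidiag n F * Q.transpose * antidiag n F = -Q ∧
    x = (Matrix.fromBlocks P (P * Q) 0
      (antidiag n F * P⁻¹.transpose * antidiag n F)).submatrix place place}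

/-! Labelled set partitions of type D. -/

/-- A `D_{2n}(q)`-partition: a finite set of labelled arcs `(i, j, a)`, with `i ≺ j` in `[±n]`,
`j ≠ -i` and `a ≠ 0`. An arc carries only one label. -/
@[ext] structure DPartition (n : ℕ) (F : Type*) [Field F] where
  arcs : Finset (PM n × PM n × F)
  lt : ∀ i j a, (i, j, a) ∈ arcs → i < j
  ne_opp : ∀ i j a, (i, j, a) ∈ arcs → j ≠ opp i
  ne_zero : ∀ i j a, (i, j, a) ∈ arcs → a ≠ 0
  label : ∀ i j a b, (i, j, a) ∈ arcs → (i, j, b) ∈ arcs → a = b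
  symm : ∀ i j a, (i, j, a) ∈ arcs → (opp j, opp i, -a) ∈ arcs
  short : ∀ i j a, (i, j, a) ∈ arcs → ∀ k, i < k → k < j → ∀ b,
    (i, k, b) ∉ arcs ∧ (k, j, b) ∉ arcs

end TypeD

namespace TypeD

/-! Order facts about `[±n]`. -/

section order
variable {n : ℕ}

theorem opp_opp (s : PM n) : opp (opp s) = s := by
  induction s using Lex.rec with | _ s => rcases s with i | i <;> rfl

theorem opp_lt (s t : PM n) : opp s < opp t ↔ t < s := by
  induction s using Lex.rec with | _ s =>
  induction t using Lex.rec with | _ t =>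
  rcases s with i | i <;> rcases t with j | j <;>
    simp [opp, Sum.Lex.inl_lt_inl_iff, Sum.Lex.inr_lt_inr_iff, Sum.Lex.inl_lt_inr,
      Sum.Lex.not_inr_lt_inl]

theorem absv_opp (s : PM n) : absv (opp s) = absv s := by
  induction s using Lex.rec with | _ s => rcases s with i | i <;> rfl

theorem unst_lt (A : Finset (Fin n)) (s t : PM A.card) : unst A s < unst A t ↔ s < t := by
  induction s using Lex.rec with | _ s =>
  induction t using Lex.rec with | _ t =>
  rcases s with i | i <;> rcases t with j | j <;>
    simp [unst, Sum.Lex.inl_lt_inl_iff, Sum.Lex.inr_lt_inr_iff, Sum.Lex.inl_lt_inr,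
      Sum.Lex.not_inr_lt_inl]

theorem unst_inj (A : Finset (Fin n)) : Function.Injective (unst A) :=
  StrictMono.injective fun s t h => (unst_lt A s t).2 h

theorem unst_opp (A : Finset (Fin n)) (s : PM A.card) : unst A (opp s) = opp (unst A s) := by
  induction s using Lex.rec with | _ s => rcases s with i | i <;> rfl

theorem absv_unst (A : Finset (Fin n)) (s : PM A.card) : absv (unst A s) ∈ A := by
  induction s using Lex.rec with | _ s => rcases s with i | i <;> simp [absv, unst]

theorem exists_unst (A : Finset (Fin n)) (s : PM n) (h : absv s ∈ A) : ∃ t, unst A t = s := by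
  have hA : Set.range (A.orderEmbOfFin rfl) = A := Finset.range_orderEmbOfFin A rfl
  induction s using Lex.rec with | _ s =>
  rcases s with i | i
  · obtain ⟨t, ht⟩ : i ∈ Set.range (A.orderEmbOfFin rfl) := by rw [hA]; exact h
    exact ⟨toLex (Sum.inl t), by simp [unst, ht]⟩
  · obtain ⟨t, ht⟩ : OrderDual.ofDual i ∈ Set.range (A.orderEmbOfFin rfl) := by rw [hA]; exact h
    exact ⟨toLex (Sum.inr (OrderDual.toDual t)), by simp [unst, ht]⟩

theorem bij_unst (A : Finset (Fin n)) :
    Function.Bijective (Sum.elim (unst A) (unst Aᶜ)) := by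
  refine ⟨(unst_inj A).sumElim (unst_inj Aᶜ) ?_, fun s => ?_⟩
  · intro a b h
    have h1 := absv_unst A a
    have h2 := absv_unst Aᶜ b
    rw [h] at h1
    exact (Finset.mem_compl.1 h2) h1
  · by_cases h : absv s ∈ A
    · obtain ⟨t, ht⟩ := exists_unst A s h
      exact ⟨Sum.inl t, ht⟩
    · obtain ⟨t, ht⟩ := exists_unst Aᶜ s (Finset.mem_compl.2 h)
      exact ⟨Sum.inr t, ht⟩

/-- `[±n]` is the disjoint union of `±A` and `±Aᶜ`. -/
def glue (A : Finset (Fin n)) : PM A.card ⊕ PM Aᶜ.card ≃ PM n :=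
  Equiv.ofBijective _ (bij_unst A)

end order

/-! Unipotent upper triangular matrices: group properties and two-sided orbits. -/

section orbits
variable {ι F : Type*} [LinearOrder ι] [Fintype ι] [Field F]

theorem uni_one : (1 : Matrix ι ι F) ∈ Uni ι F :=
  ⟨fun i => by simp, fun i j h => by simp [h.ne']⟩

theorem uni_mul {g h : Matrix ι ι F} (hg : g ∈ Uni ι F) (hh : h ∈ Uni ι F) : g * h ∈ Uni ι F := by
  refine ⟨fun i => ?_, fun i j hij => ?_⟩
  · rw [Matrix.mul_apply, Finset.sum_eq_single i]
    · simp [hg.1, hh.1]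
    · intro k _ hk
      rcases lt_or_gt_of_ne hk with hk | hk
      · simp [hg.2 i k hk]
      · simp [hh.2 k i hk]
    · simp
  · rw [Matrix.mul_apply]
    refine Finset.sum_eq_zero fun k _ => ?_
    rcases lt_or_ge k i with hk | hk
    · simp [hg.2 i k hk]
    · simp [hh.2 k j (hij.trans_le hk)]

theorem uni_det {g : Matrix ι ι F} (hg : g ∈ Uni ι F) : g.det = 1 := by
  rw [Matrix.det_of_isUpperTriangular (fun i j h => hg.2 i j h)]
  simp [hg.1]

theorem uni_isUnit {g : Matrix ι ι F} (hg : g ∈ Uni ι F) : IsUnit g.det := by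
  simp [uni_det hg]

theorem uni_inv {g : Matrix ι ι F} (hg : g ∈ Uni ι F) : g⁻¹ ∈ Uni ι F := by
  have hu := uni_isUnit hg
  have hT : Matrix.BlockTriangular g⁻¹ id := by
    have := Matrix.invertibleOfIsUnitDet g hu
    exact Matrix.blockTriangular_inv_of_blockTriangular (fun i j h => hg.2 i j h)
  refine ⟨fun i => ?_, fun i j hij => hT hij⟩
  have h1 : (g⁻¹ * g) i i = 1 := by rw [Matrix.nonsing_inv_mul g hu]; simp
  rw [Matrix.mul_apply, Finset.sum_eq_single i] at h1
  · simpa [hg.1] using h1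
  · intro k _ hk
    rcases lt_or_gt_of_ne hk with hk | hk
    · rw [show g⁻¹ i k = 0 from hT hk, zero_mul]
    · simp [hg.2 k i hk]
  · simp

/-- The two-sided orbit of `y` under the group of unipotent upper triangular matrices. -/
def orbit (y : Matrix ι ι F) : Set (Matrix ι ι F) :=
  {z | ∃ g ∈ Uni ι F, ∃ h ∈ Uni ι F, z = g * y * h}

theorem orbit_refl (y : Matrix ι ι F) : y ∈ orbit y := ⟨1, uni_one, 1, uni_one, by simp⟩

theorem orbit_symm {y z : Matrix ι ι F} (h : z ∈ orbit y) : y ∈ orbit z := by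
  obtain ⟨g, hg, k, hk, rfl⟩ := h
  refine ⟨g⁻¹, uni_inv hg, k⁻¹, uni_inv hk, ?_⟩
  rw [Matrix.mul_assoc g, Matrix.nonsing_inv_mul_cancel_left _ _ (uni_isUnit hg),
    Matrix.mul_nonsing_inv_cancel_right _ _ (uni_isUnit hk)]

theorem orbit_trans {x y z : Matrix ι ι F} (h : y ∈ orbit x) (h' : z ∈ orbit y) :
    z ∈ orbit x := by
  obtain ⟨g, hg, k, hk, rfl⟩ := h
  obtain ⟨g', hg', k', hk', rfl⟩ := h'
  exact ⟨g' * g, uni_mul hg' hg, k * k', uni_mul hk hk', by simp only [Matrix.mul_assoc]⟩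

/-- At most one nonzero entry in every row and column. -/
def Partial (y : Matrix ι ι F) : Prop :=
  (∀ i j k, y i j ≠ 0 → y i k ≠ 0 → j = k) ∧ ∀ i j k, y i k ≠ 0 → y j k ≠ 0 → i = j

theorem partial_le {y y' : Matrix ι ι F} (hy : Partial y) (hy' : Partial y')
    {g k : Matrix ι ι F} (hg : g ∈ Uni ι F) (hk : k ∈ Uni ι F) (e : g * y = y' * k)
    (i j : ι) (h : y i j ≠ 0) : ∃ c ≤ j, y' i c ≠ 0 ∧ y' i c * k c j = y i j := by
  have e1 : (g * y) i j = y i j := by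
    rw [Matrix.mul_apply, Finset.sum_eq_single i]
    · simp [hg.1]
    · intro r _ hr
      by_contra h0
      exact hr (hy.2 r i j (right_ne_zero_of_mul h0) h)
    · simp
  rw [e, Matrix.mul_apply] at e1
  obtain ⟨c, -, hc⟩ := Finset.exists_ne_zero_of_sum_ne_zero (e1.trans_ne h)
  refine ⟨c, ?_, left_ne_zero_of_mul hc, ?_⟩
  · by_contra hcj
    exact right_ne_zero_of_mul hc (hk.2 c j (not_le.1 hcj))
  · rw [← e1, Finset.sum_eq_single c]
    · intro r _ hr
      by_contra h0
      exact hr (hy'.1 i r c (left_ne_zero_of_mul h0) (left_ne_zero_of_mul hc))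
    · simp

theorem partial_entry {y y' : Matrix ι ι F} (hy : Partial y) (hy' : Partial y')
    (h : y' ∈ orbit y) (i j : ι) (hij : y i j ≠ 0) : y' i j = y i j := by
  have key : ∀ {y y' : Matrix ι ι F}, y' ∈ orbit y →
      ∃ g ∈ Uni ι F, ∃ k ∈ Uni ι F, g * y = y' * k := by
    rintro y _ ⟨g, hg, k, hk, rfl⟩
    exact ⟨g, hg, k⁻¹, uni_inv hk, by
      rw [Matrix.mul_nonsing_inv_cancel_right _ _ (uni_isUnit hk)]⟩
  obtain ⟨g, hg, k, hk, e⟩ := key h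
  obtain ⟨g', hg', k', hk', e'⟩ := key (orbit_symm h)
  obtain ⟨c, hc, hc0, hce⟩ := partial_le hy hy' hg hk e i j hij
  obtain ⟨d, hd, hd0, -⟩ := partial_le hy' hy hg' hk' e' i c hc0
  have hdj : d = j := hy.1 i d j hd0 hij
  have : c = j := le_antisymm hc (hdj ▸ hd)
  subst this
  rw [← hce, hk.1, mul_one]

theorem partial_unique {y y' : Matrix ι ι F} (hy : Partial y) (hy' : Partial y')
    (h : y' ∈ orbit y) : y' = y := by
  ext i j
  by_cases h0 : y i j = 0
  · by_contra h1
    exact h1 (partial_entry hy' hy (orbit_symm h) i j (fun h2 => h1 (h2.trans h0.symm))).symm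
  · exact partial_entry hy hy' h i j h0

theorem exists_partial_aux (z : Matrix ι ι F) (D : Finset ι) :
    IsUpperSet (D : Set ι) → ∃ y ∈ orbit z,
      ∀ r ∈ D, ∀ j, y r j ≠ 0 → (∀ k, k ≠ j → y r k = 0) ∧ ∀ s, s ≠ r → y s j = 0 := by
  induction D using Finset.induction_on_min with
  | empty => exact fun _ => ⟨z, orbit_refl z, by simp⟩
  | insert i D hi ih =>
    intro hD
    have hD' : IsUpperSet (D : Set ι) := by
      intro a b hab ha
      have := hD hab (by simp [show a ∈ D from ha])
      rcases Finset.mem_insert.1 (Finset.mem_coe.1 this) with h | h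
      · exact absurd (hi a ha) (not_lt.2 (h ▸ hab))
      · exact h
    have hgt : ∀ s, s ∉ D → s ≠ i → s < i := by
      intro s hs hsi
      by_contra hlt
      have := hD (not_lt.1 hlt) (by simp)
      rcases Finset.mem_insert.1 (Finset.mem_coe.1 this) with h | h
      · exact hsi h
      · exact hs h
    have hiD : i ∉ D := fun h => lt_irrefl _ (hi i h)
    obtain ⟨M, hM, hMD⟩ := ih hD'
    by_cases hrow : ∀ j, M i j = 0
    · refine ⟨M, hM, fun r hr j hj => ?_⟩
      rcases Finset.mem_insert.1 hr with rfl | hr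
      · exact absurd (hrow j) hj
      · exact hMD r hr j hj
    push Not at hrow
    classical
    obtain ⟨j, hj, hmin⟩ : ∃ j, M i j ≠ 0 ∧ ∀ k < j, M i k = 0 := by
      obtain ⟨j, hj⟩ := (Finset.univ.filter fun j => M i j ≠ 0).exists_minimal
        (by obtain ⟨j, hj⟩ := hrow; exact ⟨j, by simpa using hj⟩)
      refine ⟨j, by simpa using hj.1, fun k hk => ?_⟩
      by_contra h
      exact not_le.2 hk (hj.2 (by simpa using h) hk.le)
    have hDj : ∀ r ∈ D, M r j = 0 := by
      intro r hr
      by_contra h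
      exact hj ((hMD r hr j h).2 i (fun h => hiD (h ▸ hr)))
    let u : ι → F := fun r => if r < i then M r j / M i j else 0
    let v : ι → F := fun k => if j < k then M i k / M i j else 0
    let g : Matrix ι ι F := 1 - Matrix.of fun r s => if s = i then u r else 0
    let h : Matrix ι ι F := 1 - Matrix.of fun s k => if s = j then v k else 0
    have hg : g ∈ Uni ι F := by
      refine ⟨fun r => ?_, fun r s hrs => ?_⟩
      · by_cases hr : r = i <;> simp [g, u, hr]
      · by_cases hs : s = i
        · subst hs; simp [g, u, hrs.ne', not_lt.2 hrs.le]
        · simp [g, hs, hrs.ne']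
    have hh : h ∈ Uni ι F := by
      refine ⟨fun r => ?_, fun r s hrs => ?_⟩
      · by_cases hr : r = j <;> simp [h, v, hr]
      · by_cases hs : r = j
        · subst hs; simp [h, v, hrs.ne', not_lt.2 hrs.le]
        · simp [h, hs, hrs.ne']
    have hgM : ∀ (N : Matrix ι ι F) r k, (g * N) r k = N r k - u r * N i k := by
      intro N r k
      simp [g, Matrix.mul_apply, sub_mul, Finset.sum_sub_distrib, Matrix.one_apply]
    have hMh : ∀ (N : Matrix ι ι F) r k, (N * h) r k = N r k - N r j * v k := by
      intro N r k
      simp [h, Matrix.mul_apply, mul_sub, Finset.sum_sub_distrib, Matrix.one_apply]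
    have hi1 : ∀ k, k ≠ j → M i k - M i j * v k = 0 := by
      intro k hk
      rcases lt_or_gt_of_ne hk with hk | hk
      · simp [v, hmin k hk, not_lt.2 hk.le]
      · simp [v, hk]; field_simp; ring
    have hvj : v j = 0 := by simp [v]
    have hui : u i = 0 := by simp [u]
    have huD : ∀ r ∈ D, u r = 0 := fun r hr => by simp [u, not_lt.2 (hi r hr).le]
    have hcol : ∀ r, r ≠ i → M r j - u r * M i j = 0 := by
      intro r hr
      by_cases hrD : r ∈ D
      · simp [huD r hrD, hDj r hrD]
      · simp [u, hgt r hrD hr]; field_simp; ring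
    have ent : ∀ r k, (g * M * h) r k
        = (M r k - u r * M i k) - (M r j - u r * M i j) * v k := by
      intro r k
      rw [hMh, hgM, hgM]
    refine ⟨g * M * h, orbit_trans hM ⟨g, hg, h, hh, rfl⟩, fun r hr k hk => ?_⟩
    have enti : ∀ k, k ≠ j → (g * M * h) i k = 0 := by
      intro k hk
      rw [ent, hui]; simpa using hi1 k hk
    rcases Finset.mem_insert.1 hr with rfl | hrD
    · have hkj : k = j := by
        by_contra h
        exact hk (enti k h)
      subst hkj
      refine ⟨enti, fun s hs => ?_⟩
      rw [ent, hcol s hs]; simp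
    · have entr : ∀ k, (g * M * h) r k = M r k := by
        intro k
        rw [ent, huD r hrD, hDj r hrD]; simp
      rw [entr] at hk
      obtain ⟨h1, h2⟩ := hMD r hrD k hk
      refine ⟨fun k' hk' => by rw [entr, h1 k' hk'], fun s hs => ?_⟩
      have hik : M i k = 0 := h2 i (fun h => hiD (h ▸ hrD))
      have hvk : v k = 0 := by simp [v, hik]
      rw [ent, h2 s hs, hik, hvk]; simp

theorem exists_partial (z : Matrix ι ι F) : ∃ y ∈ orbit z, Partial y := by
  obtain ⟨y, hy, h⟩ := exists_partial_aux z Finset.univ (by simp [isUpperSet_univ])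
  refine ⟨y, hy, fun i j k hj hk => ?_, fun i j k hi hj => ?_⟩
  · by_contra hne
    exact hk ((h i (by simp) j hj).1 k (Ne.symm hne))
  · by_contra hne
    exact hj ((h i (by simp) k hi).2 j (Ne.symm hne))

end orbits
end TypeD

namespace TypeD

section group
variable {n : ℕ} {F : Type*} [Field F]

/-- The adjoint of a matrix for the split symmetric bilinear form pairing `i` with `-i`. -/
def adj (x : Matrix (PM n) (PM n) F) : Matrix (PM n) (PM n) F :=
  x.transpose.submatrix opp opp

theorem adj_apply (x : Matrix (PM n) (PM n) F) (i j : PM n) : adj x i j = x (opp j) (opp i) := rfl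

theorem adj_mul (x y : Matrix (PM n) (PM n) F) : adj (x * y) = adj y * adj x := by
  let e : PM n ≃ PM n := ⟨opp, opp, opp_opp, opp_opp⟩
  have : ∀ z : Matrix (PM n) (PM n) F, adj z = z.transpose.submatrix e e := fun z => rfl
  rw [this, this, this, Matrix.transpose_mul, Matrix.submatrix_mul_equiv]

theorem adj_one : adj (1 : Matrix (PM n) (PM n) F) = 1 := by
  let e : PM n ≃ PM n := ⟨opp, opp, opp_opp, opp_opp⟩
  change (1 : Matrix (PM n) (PM n) F).transpose.submatrix e e = 1
  simp

theorem adj_uni {x : Matrix (PM n) (PM n) F} (hx : x ∈ Uni (PM n) F) : adj x ∈ Uni (PM n) F :=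
  ⟨fun i => hx.1 _, fun i j h => hx.2 _ _ ((opp_lt _ _).2 h)⟩

/-- The labels of the rows and columns, first the positive and then the negative ones. -/
def lab : Fin n ⊕ Fin n ≃ PM n :=
  (Equiv.sumCongr (Equiv.refl _) OrderDual.toDual).trans toLex

theorem lab_inl_lt (i j : Fin n) : (lab (Sum.inl i) : PM n) < lab (Sum.inl j) ↔ i < j :=
  Sum.Lex.inl_lt_inl_iff

theorem lab_inr_lt (i j : Fin n) : (lab (Sum.inr i) : PM n) < lab (Sum.inr j) ↔ j < i :=
  Sum.Lex.inr_lt_inr_iff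

theorem lab_lt (i j : Fin n) : (lab (Sum.inl i) : PM n) < lab (Sum.inr j) :=
  Sum.Lex.inl_lt_inr _ _

theorem antidiag_conj (M : Matrix (Fin n) (Fin n) F) (i j : Fin n) :
    (antidiag n F * M * antidiag n F) i j = M i.rev j.rev := by
  have h : ∀ k : Fin n, (j = Fin.rev k) ↔ (k = Fin.rev j) := fun k =>
    ⟨fun h => by rw [h, Fin.rev_rev], fun h => by rw [h, Fin.rev_rev]⟩
  simp [antidiag, Matrix.mul_apply, h]

theorem fromBlocks_lab (P Q : Matrix (Fin n) (Fin n) F) :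
    ((Matrix.fromBlocks P (P * Q) 0 (antidiag n F * P⁻¹.transpose * antidiag n F)).submatrix
      place place : Matrix (PM n) (PM n) F).submatrix lab lab =
    Matrix.fromBlocks P (P * Q.submatrix id Fin.rev) 0 P⁻¹.transpose := by
  ext i j
  rcases i with i | i <;> rcases j with j | j
  · rfl
  · rfl
  · rfl
  · change (antidiag n F * P⁻¹.transpose * antidiag n F) i.rev j.rev = _
    rw [antidiag_conj, Fin.rev_rev, Fin.rev_rev]; rfl

theorem adj_lab (A B C D : Matrix (Fin n) (Fin n) F) (x : Matrix (PM n) (PM n) F)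
    (hx : x.submatrix lab lab = Matrix.fromBlocks A B C D) :
    (adj x).submatrix lab lab =
      Matrix.fromBlocks D.transpose B.transpose C.transpose A.transpose := by
  have h : ∀ i j, x (lab i) (lab j) = Matrix.fromBlocks A B C D i j := fun i j => by
    rw [← hx]; rfl
  ext i j
  rcases i with i | i <;> rcases j with j | j
  · exact h (Sum.inr j) (Sum.inr i)
  · exact h (Sum.inl j) (Sum.inr i)
  · exact h (Sum.inr j) (Sum.inl i)
  · exact h (Sum.inl j) (Sum.inl i)

theorem skew_iff (Q : Matrix (Fin n) (Fin n) F) :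
    antidiag n F * Q.transpose * antidiag n F = -Q ↔
      (Q.submatrix id Fin.rev).transpose = -(Q.submatrix id Fin.rev) := by
  constructor
  · intro h
    ext i j
    have := congrFun (congrFun h i) j.rev
    rw [antidiag_conj, Fin.rev_rev] at this
    simpa using this
  · intro h
    ext i j
    have := congrFun (congrFun h i) j.rev
    rw [antidiag_conj]
    simpa using this

/-- The group of type D consists of the unipotent upper triangular isometries of the form. -/
theorem mem_UD_iff (x : Matrix (PM n) (PM n) F) :
    x ∈ UD n F ↔ x ∈ Uni (PM n) F ∧ x * adj x = 1 := by
  have mul1 : x * adj x = 1 ↔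
      x.submatrix lab lab * (adj x).submatrix lab lab = 1 := by
    rw [Matrix.submatrix_mul_equiv]
    constructor
    · intro h; rw [h, Matrix.submatrix_one_equiv]
    · intro h
      have := congrArg (fun m => m.submatrix lab.symm lab.symm) h
      simpa using this
  constructor
  · rintro ⟨P, hP, Q, hQ, e⟩
    have hx := fromBlocks_lab P Q
    rw [← e] at hx
    have hu := uni_isUnit hP
    have hPi := uni_inv hP
    have ent : ∀ i j, x (lab i) (lab j) = Matrix.fromBlocks P (P * Q.submatrix id Fin.rev) 0
        P⁻¹.transpose i j := fun i j => by rw [← hx]; rfl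
    refine ⟨⟨fun i => ?_, fun i j hij => ?_⟩, ?_⟩
    · obtain ⟨i, rfl⟩ := lab.surjective i
      rw [ent]
      rcases i with i | i
      · exact hP.1 i
      · exact hPi.1 i
    · obtain ⟨i, rfl⟩ := lab.surjective i
      obtain ⟨j, rfl⟩ := lab.surjective j
      rw [ent]
      rcases i with i | i <;> rcases j with j | j
      · exact hP.2 i j ((lab_inl_lt _ _).1 hij)
      · exact absurd hij (lab_lt i j).asymm
      · rfl
      · exact hPi.2 j i ((lab_inr_lt _ _).1 hij)
    · rw [mul1, adj_lab _ _ _ _ x hx, hx, Matrix.fromBlocks_multiply, ← Matrix.fromBlocks_one]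
      rw [skew_iff] at hQ
      congr 1
      · simp [Matrix.mul_nonsing_inv P hu]
      · rw [Matrix.transpose_mul, hQ]; simp [Matrix.mul_assoc]
      · simp
      · simp [← Matrix.transpose_mul, Matrix.mul_nonsing_inv P hu]
  · rintro ⟨hU, hO⟩
    obtain ⟨A, B, C, D, hx⟩ : ∃ A B C D, x.submatrix lab lab = Matrix.fromBlocks A B C D :=
      ⟨_, _, _, _, (Matrix.fromBlocks_toBlocks _).symm⟩
    have ent : ∀ i j, x (lab i) (lab j) = Matrix.fromBlocks A B C D i j := fun i j => by
      rw [← hx]; rfl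
    have hC : C = 0 := by
      ext i j
      exact (ent (Sum.inr i) (Sum.inl j)).symm.trans (hU.2 _ _ (lab_lt j i))
    have hA : A ∈ Uni (Fin n) F :=
      ⟨fun i => (ent (Sum.inl i) (Sum.inl i)).symm.trans (hU.1 _), fun i j h =>
        (ent (Sum.inl i) (Sum.inl j)).symm.trans (hU.2 _ _ ((lab_inl_lt _ _).2 h))⟩
    have hu := uni_isUnit hA
    subst hC
    rw [mul1, adj_lab _ _ _ _ x hx, hx, Matrix.fromBlocks_multiply, ← Matrix.fromBlocks_one,
      Matrix.fromBlocks_inj] at hO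
    obtain ⟨h1, h2, -, h4⟩ := hO
    have hD : D = A⁻¹.transpose := by
      have : A * D.transpose = 1 := by simpa using h1
      rw [Matrix.inv_eq_right_inv this, Matrix.transpose_transpose]
    have hadd : A * B.transpose = -(B * A.transpose) := eq_neg_of_add_eq_zero_left h2
    have hQ' : ((A⁻¹ * B).submatrix id Fin.rev).submatrix id Fin.rev = A⁻¹ * B := by
      ext i j; simp [Matrix.submatrix]
    have hxx : x.submatrix lab lab = ((Matrix.fromBlocks A (A * (A⁻¹ * B).submatrix id Fin.rev) 0
        (antidiag n F * A⁻¹.transpose * antidiag n F)).submatrix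
        place place : Matrix (PM n) (PM n) F).submatrix lab lab := by
      rw [fromBlocks_lab, hQ', hx, hD, Matrix.mul_nonsing_inv_cancel_left _ _ hu]
    refine ⟨A, hA, (A⁻¹ * B).submatrix id Fin.rev, ?_, ?_⟩
    · rw [skew_iff, hQ']
      have hut : IsUnit A.transpose.det := by rwa [Matrix.det_transpose]
      calc (A⁻¹ * B).transpose = A⁻¹ * (A * B.transpose) * A⁻¹.transpose := by
            rw [Matrix.nonsing_inv_mul_cancel_left _ _ hu, Matrix.transpose_mul]
        _ = -(A⁻¹ * B) := by
            rw [hadd, Matrix.transpose_nonsing_inv, Matrix.mul_neg, Matrix.neg_mul,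
              ← Matrix.mul_assoc, Matrix.mul_nonsing_inv_cancel_right _ _ hut]
    · ext i j
      obtain ⟨i, rfl⟩ := lab.surjective i
      obtain ⟨j, rfl⟩ := lab.surjective j
      exact congrFun (congrFun hxx i) j

end group
end TypeD

namespace TypeD

/-! Superclasses and superclass functions. -/

section super
variable {n : ℕ} {F : Type*} [Field F]

/-- The matrix `y_λ = ∑ a e_{ij}`, summed over the arcs `(i, j, a)` of `λ`. -/
def DPartition.mat (lam : DPartition n F) : Matrix (PM n) (PM n) F :=
  ∑ t ∈ lam.arcs, Matrix.single t.1 t.2.1 t.2.2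

/-- The superclass `K_λ`: the elements `x` of the group of type D such that `x - 1` lies in the
two-sided orbit of `y_λ` under the unipotent upper triangular matrices. -/
def superclass (lam : DPartition n F) : Set (UD n F) :=
  {x | (x : Matrix (PM n) (PM n) F) - 1 ∈ orbit lam.mat}

/-- The space of superclass functions on the group of type D. -/
def SC (n : ℕ) (F : Type*) [Field F] : Submodule ℂ (UD n F → ℂ) where
  carrier := {f | ∀ lam : DPartition n F, ∀ x ∈ superclass lam, ∀ y ∈ superclass lam, f x = f y}
  add_mem' := fun {f g} hf hg lam x hx y hy => by
    rw [Pi.add_apply, Pi.add_apply, hf lam x hx y hy, hg lam x hx y hy]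
  zero_mem' := fun _ _ _ _ _ => rfl
  smul_mem' := fun c f hf lam x hx y hy => by
    rw [Pi.smul_apply, Pi.smul_apply, hf lam x hx y hy]

theorem superclass_congr (lam : DPartition n F) (x y : UD n F)
    (h : (y : Matrix (PM n) (PM n) F) - 1 ∈ orbit ((x : Matrix (PM n) (PM n) F) - 1)) :
    x ∈ superclass lam ↔ y ∈ superclass lam :=
  ⟨fun hx => orbit_trans hx h, fun hy => orbit_trans hy (orbit_symm h)⟩

theorem superclass_orbit (lam : DPartition n F) (x y : UD n F) (hx : x ∈ superclass lam)
    (hy : y ∈ superclass lam) :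
    (y : Matrix (PM n) (PM n) F) - 1 ∈ orbit ((x : Matrix (PM n) (PM n) F) - 1) :=
  orbit_trans (orbit_symm hx) hy

open Classical in
/-- The superclass characteristic function `κ_λ`. -/
def kappa (lam : DPartition n F) : SC n F :=
  ⟨fun x => if x ∈ superclass lam then 1 else 0, fun mu x hx y hy => by
    have := superclass_congr lam x y (superclass_orbit mu x y hx hy)
    simp [this]⟩

theorem mat_of_partial (y : Matrix (PM n) (PM n) F) (lam : DPartition n F)
    (h : ∀ i j a, (i, j, a) ∈ lam.arcs ↔ a ≠ 0 ∧ y i j = a) : lam.mat = y := by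
  classical
  ext i j
  rw [DPartition.mat, Matrix.sum_apply]
  by_cases h0 : y i j = 0
  · rw [h0]
    refine Finset.sum_eq_zero ?_
    rintro ⟨r, s, a⟩ ht
    rw [Matrix.single_apply]
    split_ifs with h1
    · obtain ⟨rfl, rfl⟩ := h1
      obtain ⟨h2, h3⟩ := (h _ _ _).1 ht
      exact absurd (h3.symm.trans h0) h2
    · rfl
  · rw [Finset.sum_eq_single (i, j, y i j)]
    · simp
    · rintro ⟨r, s, a⟩ ht hne
      rw [Matrix.single_apply, if_neg]
      rintro ⟨rfl, rfl⟩
      exact hne (by rw [((h _ _ _).1 ht).2])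
    · intro hn
      exact absurd ((h _ _ _).2 ⟨h0, rfl⟩) hn

theorem exists_mat [NeZero (2 : F)] (y : Matrix (PM n) (PM n) F) (hP : Partial y)
    (hsym : ∀ i j, y (opp j) (opp i) = -y i j) (hlow : ∀ i j, y i j ≠ 0 → i < j) :
    ∃ lam : DPartition n F, lam.mat = y := by
  classical
  obtain ⟨S, hmem⟩ : ∃ S : Finset (PM n × PM n × F),
      ∀ i j a, (i, j, a) ∈ S ↔ a ≠ 0 ∧ y i j = a := by
    refine ⟨((Finset.univ : Finset (PM n × PM n)).filter
      fun p => y p.1 p.2 ≠ 0).image fun p => (p.1, p.2, y p.1 p.2), fun i j a => ?_⟩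
    simp only [Finset.mem_image, Finset.mem_filter, Finset.mem_univ, true_and, Prod.mk.injEq,
      Prod.exists]
    constructor
    · rintro ⟨r, s, h1, rfl, rfl, rfl⟩
      exact ⟨h1, rfl⟩
    · rintro ⟨h1, rfl⟩
      exact ⟨i, j, h1, rfl, rfl, rfl⟩
  exact ⟨
    { arcs := S
      lt := fun i j a ha => by
        obtain ⟨h1, rfl⟩ := (hmem _ _ _).1 ha
        exact hlow i j h1
      ne_opp := fun i j a ha => by
        obtain ⟨h1, rfl⟩ := (hmem _ _ _).1 ha
        rintro rfl
        have := hsym i (opp i)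
        rw [opp_opp, eq_neg_iff_add_eq_zero, ← two_mul] at this
        exact h1 ((mul_eq_zero.1 this).resolve_left (NeZero.ne 2))
      ne_zero := fun i j a ha => ((hmem _ _ _).1 ha).1
      label := fun i j a b ha hb => ((hmem _ _ _).1 ha).2.symm.trans ((hmem _ _ _).1 hb).2
      symm := fun i j a ha => by
        obtain ⟨h1, rfl⟩ := (hmem _ _ _).1 ha
        exact (hmem _ _ _).2 ⟨neg_ne_zero.2 h1, hsym i j⟩
      short := fun i j a ha k hik hkj b => by
        obtain ⟨h1, rfl⟩ := (hmem _ _ _).1 ha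
        refine ⟨fun hb => ?_, fun hb => ?_⟩
        · obtain ⟨h2, rfl⟩ := (hmem _ _ _).1 hb
          exact hkj.ne (hP.1 i k j h2 h1)
        · obtain ⟨h2, rfl⟩ := (hmem _ _ _).1 hb
          exact hik.ne (hP.2 i k j h1 h2) }, mat_of_partial y _ hmem⟩

/-- Every element of the group of type D lies in a superclass. -/
theorem exists_superclass [NeZero (2 : F)] (x : UD n F) :
    ∃ lam : DPartition n F, x ∈ superclass lam := by
  classical
  obtain ⟨x, hxD⟩ := x
  obtain ⟨hU, hO⟩ := (mem_UD_iff x).1 hxD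
  obtain ⟨y, hy, hP⟩ := exists_partial (x - 1)
  obtain ⟨g, hg, h, hh, e⟩ := hy
  have hadj : adj (x - 1) = -(adj x * (x - 1)) := by
    have h1 : adj (x - 1) = adj x - 1 := by
      ext i j
      have := congrFun (congrFun (adj_one (n := n) (F := F)) i) j
      simp only [adj_apply, Matrix.sub_apply] at this ⊢
      rw [this]
    have h2 : adj x * x = 1 := mul_eq_one_comm.1 hO
    rw [h1, Matrix.mul_sub, h2, Matrix.mul_one]; abel
  have hneg : -adj y = (adj h * adj x) * (x - 1) * adj g := by
    rw [e, adj_mul, adj_mul, hadj]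
    simp only [Matrix.mul_assoc, Matrix.mul_neg, Matrix.neg_mul, neg_neg]
  have hor : -adj y ∈ orbit y :=
    orbit_trans (orbit_symm ⟨g, hg, h, hh, e⟩)
      ⟨_, uni_mul (adj_uni hh) (adj_uni hU), _, adj_uni hg, hneg⟩
  have hPa : Partial (-adj y) := by
    constructor
    · intro i j k hj hk
      have := hP.2 (opp j) (opp k) (opp i) (by simpa [adj_apply] using hj)
        (by simpa [adj_apply] using hk)
      rw [← opp_opp j, this, opp_opp]
    · intro i j k hj hk
      have := hP.1 (opp k) (opp i) (opp j) (by simpa [adj_apply] using hj)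
        (by simpa [adj_apply] using hk)
      rw [← opp_opp i, this, opp_opp]
  have hya : -adj y = y := partial_unique hP hPa hor
  have hsym : ∀ i j, y (opp j) (opp i) = -y i j := by
    intro i j
    have := congrFun (congrFun hya i) j
    rw [← this]; simp [adj_apply]
  have hlow : ∀ i j, y i j ≠ 0 → i < j := by
    intro i j hij
    by_contra hlt
    rw [not_lt] at hlt
    refine hij ?_
    rw [e, Matrix.mul_apply]
    refine Finset.sum_eq_zero fun k _ => ?_
    rcases lt_or_ge j k with hk | hk
    · rw [hh.2 k j hk, mul_zero]
    rw [Matrix.mul_apply, Finset.sum_eq_zero, zero_mul]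
    intro r _
    rcases lt_or_ge r i with hr | hr
    · rw [hg.2 i r hr, zero_mul]
    rcases (hk.trans (hlt.trans hr)).lt_or_eq with hkr | hkr
    · rw [Matrix.sub_apply, hU.2 r k hkr, Matrix.one_apply_ne hkr.ne']; simp
    · subst hkr; simp [hU.1]
  obtain ⟨lam, hlam⟩ := exists_mat y hP hsym hlow
  refine ⟨lam, ?_⟩
  change x - 1 ∈ orbit lam.mat
  rw [hlam]
  exact orbit_symm ⟨g, hg, h, hh, e⟩

theorem SC_congr [NeZero (2 : F)] (f : SC n F) (x y : UD n F)
    (h : (y : Matrix (PM n) (PM n) F) - 1 ∈ orbit ((x : Matrix (PM n) (PM n) F) - 1)) :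
    (f : UD n F → ℂ) x = (f : UD n F → ℂ) y := by
  obtain ⟨lam, hl⟩ := exists_superclass x
  exact f.2 lam x hl y ((superclass_congr lam x y h).1 hl)

end super

/-! Superclass functions on a product of two groups of type D. -/

section tensor
variable {k l : ℕ} {F : Type*} [Field F]

/-- The functions on a product of two groups that are constant on products of superclasses. -/
def SCProd (k l : ℕ) (F : Type*) [Field F] : Submodule ℂ (UD k F × UD l F → ℂ) where
  carrier := {f | ∀ (mu : DPartition k F) (nu : DPartition l F),
    ∀ u ∈ superclass mu, ∀ u' ∈ superclass mu, ∀ v ∈ superclass nu, ∀ v' ∈ superclass nu,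
      f (u, v) = f (u', v')}
  add_mem' := fun {f g} hf hg mu nu u hu u' hu' v hv v' hv' => by
    rw [Pi.add_apply, Pi.add_apply, hf mu nu u hu u' hu' v hv v' hv',
      hg mu nu u hu u' hu' v hv v' hv']
  zero_mem' := fun _ _ _ _ _ _ _ _ _ _ => rfl
  smul_mem' := fun c f hf mu nu u hu u' hu' v hv v' hv' => by
    rw [Pi.smul_apply, Pi.smul_apply, hf mu nu u hu u' hu' v hv v' hv']

/-- The map `α ⊗ β ↦ ((u, v) ↦ α(u) β(v))`. -/
def tensorHom (k l : ℕ) (F : Type*) [Field F] : SC k F ⊗[ℂ] SC l F →ₗ[ℂ] SCProd k l F :=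
  TensorProduct.lift (LinearMap.mk₂ ℂ
    (fun f g => ⟨fun p => (f : UD k F → ℂ) p.1 * (g : UD l F → ℂ) p.2,
      fun mu nu u hu u' hu' v hv v' hv' => by
        simp only [f.2 mu u hu u' hu', g.2 nu v hv v' hv']⟩)
    (fun f f' g => by ext p; simp [add_mul])
    (fun c f g => by ext p; simp [mul_assoc])
    (fun f g g' => by ext p; simp [mul_add])
    (fun c f g => by ext p; simp [mul_left_comm]))

theorem tensorHom_tmul (f : SC k F) (g : SC l F) (p : UD k F × UD l F) :
    (tensorHom k l F (f ⊗ₜ g) : UD k F × UD l F → ℂ) p =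
      (f : UD k F → ℂ) p.1 * (g : UD l F → ℂ) p.2 := rfl

variable [Finite F]

theorem tensorHom_injective : Function.Injective (tensorHom k l F) := by
  have : Finite (Matrix (PM k) (PM k) F) := inferInstanceAs (Finite (PM k → PM k → F))
  have : Finite (Matrix (PM l) (PM l) F) := inferInstanceAs (Finite (PM l → PM l → F))
  have : Fintype (UD l F) := Fintype.ofFinite _
  classical
  have key : ∀ (t : SC k F ⊗[ℂ] SC l F) u v,
      TensorProduct.piScalarRight ℂ ℂ (UD k F → ℂ) (UD l F)
        (TensorProduct.map (SC k F).subtype (SC l F).subtype t) v u =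
      (tensorHom k l F t : UD k F × UD l F → ℂ) (u, v) := by
    intro t u v
    induction t with
    | zero => simp
    | tmul f g => simp [tensorHom_tmul, TensorProduct.piScalarRight_apply, mul_comm]
    | add a b ha hb => simp only [map_add, Pi.add_apply, ha, hb, Submodule.coe_add]
  intro s t hst
  have hinj : Function.Injective (TensorProduct.map (SC k F).subtype (SC l F).subtype) :=
    TensorProduct.map_injective_of_flat_flat _ _ Subtype.val_injective Subtype.val_injective
  apply hinj
  apply (TensorProduct.piScalarRight ℂ ℂ (UD k F → ℂ) (UD l F)).injective
  ext v u
  rw [key, key, hst]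

theorem tensorHom_surjective [NeZero (2 : F)] : Function.Surjective (tensorHom k l F) := by
  have : Finite (Matrix (PM k) (PM k) F) := inferInstanceAs (Finite (PM k → PM k → F))
  classical
  intro f
  let S : Setoid (UD k F) :=
    { r := fun x y => (y : Matrix (PM k) (PM k) F) - 1 ∈ orbit ((x : Matrix (PM k) (PM k) F) - 1)
      iseqv := ⟨fun x => orbit_refl _, orbit_symm, orbit_trans⟩ }
  have : Fintype (Quotient S) := Fintype.ofFinite _
  let a : Quotient S → SC k F := fun c =>
    ⟨fun x => if (Quotient.mk S x) = c then 1 else 0, fun mu x hx y hy => by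
      have : Quotient.mk S x = Quotient.mk S y :=
        Quotient.sound (superclass_orbit mu x y hx hy)
      simp [this]⟩
  let b : Quotient S → SC l F := fun c =>
    ⟨fun v => (f : UD k F × UD l F → ℂ) (c.out, v), fun nu v hv v' hv' => by
      obtain ⟨mu, hmu⟩ := exists_superclass c.out
      exact f.2 mu nu _ hmu _ hmu v hv v' hv'⟩
  refine ⟨∑ c, a c ⊗ₜ b c, ?_⟩
  ext ⟨u, v⟩
  rw [map_sum, Submodule.coe_sum, Finset.sum_apply, Finset.sum_eq_single (Quotient.mk S u)]
  · rw [tensorHom_tmul]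
    simp only [a, b, if_true, one_mul]
    obtain ⟨mu, hmu⟩ := exists_superclass (Quotient.mk S u).out
    obtain ⟨nu, hnu⟩ := exists_superclass v
    have h : (u : Matrix (PM k) (PM k) F) - 1 ∈
        orbit (((Quotient.mk S u).out : Matrix (PM k) (PM k) F) - 1) :=
      Quotient.mk_out (s := S) u
    exact f.2 mu nu _ hmu _ ((superclass_congr mu _ u h).1 hmu) v hnu v hnu
  · intro c _ hc
    rw [tensorHom_tmul]
    simp only [a, if_neg hc.symm, zero_mul]
  · simp

/-- Superclass functions on a product of two groups are identified with tensors. -/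
def tensorEquiv (k l : ℕ) (F : Type*) [Field F] [Finite F] [NeZero (2 : F)] :
    SC k F ⊗[ℂ] SC l F ≃ₗ[ℂ] SCProd k l F :=
  LinearEquiv.ofBijective (tensorHom k l F) ⟨tensorHom_injective, tensorHom_surjective⟩

end tensor

/-! Restriction and coproduct. -/

section coproduct
variable {n : ℕ} {F : Type*} [Field F]

/-- The subgroup `U_J` for `J = (A | Aᶜ)`: the matrices whose `(i, j)` entry is nonzero only if
`i` and `j` both lie in `±A` or both lie in `±Aᶜ`. -/
def UJ (A : Finset (Fin n)) (F : Type*) [Field F] : Set (UD n F) :=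
  {x | ∀ i j, (x : Matrix (PM n) (PM n) F) i j ≠ 0 → (absv i ∈ A ↔ absv j ∈ A)}

theorem submatrix_mem (x : Matrix (PM n) (PM n) F) (hx : x ∈ UD n F) (B : Finset (Fin n))
    (h : ∀ i j, x i j ≠ 0 → absv i ∈ B → absv j ∈ B) :
    x.submatrix (unst B) (unst B) ∈ UD B.card F := by
  obtain ⟨hU, hO⟩ := (mem_UD_iff x).1 hx
  refine (mem_UD_iff _).2 ⟨⟨fun i => hU.1 _, fun i j hij => hU.2 _ _ ((unst_lt B _ _).2 hij)⟩, ?_⟩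
  ext i j
  have e := congrFun (congrFun hO (unst B i)) (unst B j)
  rw [Matrix.one_apply] at e ⊢
  simp only [(unst_inj B).eq_iff] at e
  rw [← e, Matrix.mul_apply, Matrix.mul_apply]
  refine Fintype.sum_of_injective (unst B) (unst_inj B) _ _ ?_ ?_
  · intro r hr
    by_contra h0
    exact hr (exists_unst B r (h _ r (left_ne_zero_of_mul h0) (absv_unst B i)))
  · intro r
    simp only [adj_apply, Matrix.submatrix_apply, unst_opp]

/-- Reordering of rows and columns, from `U_J` to the product of the smaller groups. -/
def stMap (A : Finset (Fin n)) (F : Type*) [Field F] (x : UJ A F) :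
    UD A.card F × UD Aᶜ.card F :=
  (⟨(x.1 : Matrix (PM n) (PM n) F).submatrix (unst A) (unst A),
    submatrix_mem _ x.1.2 A fun i j h => (x.2 i j h).1⟩,
   ⟨(x.1 : Matrix (PM n) (PM n) F).submatrix (unst Aᶜ) (unst Aᶜ),
    submatrix_mem _ x.1.2 Aᶜ fun i j h hi => by
      rw [Finset.mem_compl] at hi ⊢
      exact fun hj => hi ((x.2 i j h).2 hj)⟩)

/-- The block sum of two matrices along `±A` and `±Aᶜ`. -/
def blk (A : Finset (Fin n)) (u : Matrix (PM A.card) (PM A.card) F)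
    (v : Matrix (PM Aᶜ.card) (PM Aᶜ.card) F) : Matrix (PM n) (PM n) F :=
  (Matrix.fromBlocks u 0 0 v).submatrix (glue A).symm (glue A).symm

theorem blk_apply (A : Finset (Fin n)) (u : Matrix (PM A.card) (PM A.card) F)
    (v : Matrix (PM Aᶜ.card) (PM Aᶜ.card) F) (i j) :
    blk A u v (glue A i) (glue A j) = Matrix.fromBlocks u 0 0 v i j := by
  simp [blk]

theorem blk_mul (A : Finset (Fin n)) (u u' : Matrix (PM A.card) (PM A.card) F)
    (v v' : Matrix (PM Aᶜ.card) (PM Aᶜ.card) F) :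
    blk A u v * blk A u' v' = blk A (u * u') (v * v') := by
  simp [blk, Matrix.submatrix_mul_equiv, Matrix.fromBlocks_multiply]

theorem blk_one (A : Finset (Fin n)) : blk A (1 : Matrix (PM A.card) (PM A.card) F) 1 = 1 := by
  simp [blk]

theorem blk_sub (A : Finset (Fin n)) (u u' : Matrix (PM A.card) (PM A.card) F)
    (v v' : Matrix (PM Aᶜ.card) (PM Aᶜ.card) F) :
    blk A u v - blk A u' v' = blk A (u - u') (v - v') := by
  ext i j
  obtain ⟨i, rfl⟩ := (glue A).surjective i
  obtain ⟨j, rfl⟩ := (glue A).surjective j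
  rw [Matrix.sub_apply, blk_apply, blk_apply, blk_apply]
  rcases i with i | i <;> rcases j with j | j <;> simp

theorem glue_opp (A : Finset (Fin n)) (i : PM A.card ⊕ PM Aᶜ.card) :
    opp (glue A i) = glue A (Sum.map opp opp i) := by
  rcases i with i | i
  · exact (unst_opp A i).symm
  · exact (unst_opp Aᶜ i).symm

theorem blk_adj (A : Finset (Fin n)) (u : Matrix (PM A.card) (PM A.card) F)
    (v : Matrix (PM Aᶜ.card) (PM Aᶜ.card) F) : adj (blk A u v) = blk A (adj u) (adj v) := by
  ext i j
  obtain ⟨i, rfl⟩ := (glue A).surjective i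
  obtain ⟨j, rfl⟩ := (glue A).surjective j
  rw [adj_apply, glue_opp, glue_opp, blk_apply, blk_apply]
  rcases i with i | i <;> rcases j with j | j <;> simp [adj_apply]

theorem blk_uni (A : Finset (Fin n)) {u : Matrix (PM A.card) (PM A.card) F}
    {v : Matrix (PM Aᶜ.card) (PM Aᶜ.card) F} (hu : u ∈ Uni _ F) (hv : v ∈ Uni _ F) :
    blk A u v ∈ Uni (PM n) F := by
  refine ⟨fun i => ?_, fun i j hij => ?_⟩
  · obtain ⟨i, rfl⟩ := (glue A).surjective i
    rw [blk_apply]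
    rcases i with i | i
    · exact hu.1 i
    · exact hv.1 i
  · obtain ⟨i, rfl⟩ := (glue A).surjective i
    obtain ⟨j, rfl⟩ := (glue A).surjective j
    rw [blk_apply]
    rcases i with i | i <;> rcases j with j | j
    · exact hu.2 i j ((unst_lt A _ _).1 hij)
    · rfl
    · rfl
    · exact hv.2 i j ((unst_lt Aᶜ _ _).1 hij)

theorem blk_UD (A : Finset (Fin n)) {u : Matrix (PM A.card) (PM A.card) F}
    {v : Matrix (PM Aᶜ.card) (PM Aᶜ.card) F} (hu : u ∈ UD _ F) (hv : v ∈ UD _ F) :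
    blk A u v ∈ UD n F := by
  rw [mem_UD_iff] at hu hv ⊢
  exact ⟨blk_uni A hu.1 hv.1, by rw [blk_adj, blk_mul, hu.2, hv.2, blk_one]⟩

theorem eq_blk (A : Finset (Fin n)) (x : UJ A F) :
    (x.1 : Matrix (PM n) (PM n) F) = blk A (stMap A F x).1 (stMap A F x).2 := by
  have h0 : ∀ i j, ¬ (absv i ∈ A ↔ absv j ∈ A) → (x.1 : Matrix (PM n) (PM n) F) i j = 0 :=
    fun i j h => by
      by_contra h1
      exact h (x.2 i j h1)
  ext i j
  obtain ⟨i, rfl⟩ := (glue A).surjective i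
  obtain ⟨j, rfl⟩ := (glue A).surjective j
  rw [blk_apply]
  rcases i with i | i <;> rcases j with j | j
  · rfl
  · refine h0 _ _ fun h => ?_
    exact Finset.mem_compl.1 (absv_unst Aᶜ j) (h.1 (absv_unst A i))
  · refine h0 _ _ fun h => ?_
    exact Finset.mem_compl.1 (absv_unst Aᶜ i) (h.2 (absv_unst A j))
  · rfl

theorem stMap_bijective (A : Finset (Fin n)) : Function.Bijective (stMap A F) := by
  refine ⟨fun x y h => ?_, fun ⟨u, v⟩ => ?_⟩
  · apply Subtype.ext
    apply Subtype.ext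
    rw [eq_blk A x, eq_blk A y, h]
  · have hJ : (⟨blk A u v, blk_UD A u.2 v.2⟩ : UD n F) ∈ UJ A F := by
      intro i j hij
      obtain ⟨i, rfl⟩ := (glue A).surjective i
      obtain ⟨j, rfl⟩ := (glue A).surjective j
      change blk A u.1 v.1 _ _ ≠ 0 at hij
      rw [blk_apply] at hij
      rcases i with i | i <;> rcases j with j | j
      · exact iff_of_true (absv_unst A i) (absv_unst A j)
      · exact absurd rfl hij
      · exact absurd rfl hij
      · exact iff_of_false (Finset.mem_compl.1 (absv_unst Aᶜ i))
          (Finset.mem_compl.1 (absv_unst Aᶜ j))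
    refine ⟨⟨_, hJ⟩, ?_⟩
    refine Prod.ext (Subtype.ext ?_) (Subtype.ext ?_)
    · ext i j
      exact blk_apply A u.1 v.1 (Sum.inl i) (Sum.inl j)
    · ext i j
      exact blk_apply A u.1 v.1 (Sum.inr i) (Sum.inr j)

/-- The bijection `st_J` from `U_J` onto the product of two groups of type D, for
`J = (A | Aᶜ)`. -/
def stJ (A : Finset (Fin n)) (F : Type*) [Field F] : UJ A F ≃ UD A.card F × UD Aᶜ.card F :=
  Equiv.ofBijective (stMap A F) (stMap_bijective A)

theorem stJ_symm_val (A : Finset (Fin n)) (p : UD A.card F × UD Aᶜ.card F) :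
    (((stJ A F).symm p).1 : Matrix (PM n) (PM n) F) = blk A p.1 p.2 := by
  have h : stMap A F ((stJ A F).symm p) = p := (stJ A F).apply_symm_apply p
  rw [eq_blk A ((stJ A F).symm p), h]

/-- The restriction of superclass functions, `χ ↦ (u ↦ χ(st_J⁻¹(u)))`. -/
def resProd [NeZero (2 : F)] (A : Finset (Fin n)) : SC n F →ₗ[ℂ] SCProd A.card Aᶜ.card F where
  toFun χ := ⟨fun u => (χ : UD n F → ℂ) ((stJ A F).symm u).1, by
    intro mu nu u hu u' hu' v hv v' hv'
    apply SC_congr χ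
    obtain ⟨g, hg, h, hh, e⟩ := superclass_orbit mu u u' hu hu'
    obtain ⟨g', hg', h', hh', e'⟩ := superclass_orbit nu v v' hv hv'
    refine ⟨_, blk_uni A hg hg', _, blk_uni A hh hh', ?_⟩
    rw [stJ_symm_val, stJ_symm_val, ← blk_one A, blk_sub, blk_sub, blk_mul, blk_mul, ← e, ← e']⟩
  map_add' _ _ := rfl
  map_smul' _ _ := rfl

/-- The restriction map with values in the tensor product. -/
def res [Finite F] [NeZero (2 : F)] (A : Finset (Fin n)) :
    SC n F →ₗ[ℂ] SC A.card F ⊗[ℂ] SC Aᶜ.card F :=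
  (tensorEquiv A.card Aᶜ.card F).symm.toLinearMap ∘ₗ resProd A

/-- The graded vector space of superclass functions. -/
abbrev SCD (F : Type*) [Field F] := ⨁ n, SC n F

/-- The inclusion of the component of superclass functions on the `n`-th group. -/
def incl (n : ℕ) (F : Type*) [Field F] : SC n F →ₗ[ℂ] SCD F :=
  DirectSum.lof ℂ ℕ (fun n => SC n F) n

/-- The coproduct: on the `n`-th component, the sum of the restrictions over all ordered
D-set partitions `(A | Aᶜ)` of `[±n]`. -/
def coproduct (F : Type*) [Field F] [Finite F] [NeZero (2 : F)] :
    SCD F →ₗ[ℂ] SCD F ⊗[ℂ] SCD F :=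
  DirectSum.toModule ℂ ℕ _ fun n => ∑ A : Finset (Fin n),
    TensorProduct.map (incl A.card F) (incl Aᶜ.card F) ∘ₗ res A

/-- The restriction `λ|_A`: the arcs of `λ` with both ends in `±A`. -/
def DPartition.restrict (lam : DPartition n F) (A : Finset (Fin n)) : DPartition n F where
  arcs := lam.arcs.filter fun t => absv t.1 ∈ A ∧ absv t.2.1 ∈ A
  lt i j a h := lam.lt i j a (Finset.mem_filter.1 h).1
  ne_opp i j a h := lam.ne_opp i j a (Finset.mem_filter.1 h).1
  ne_zero i j a h := lam.ne_zero i j a (Finset.mem_filter.1 h).1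
  label i j a b h h' := lam.label i j a b (Finset.mem_filter.1 h).1 (Finset.mem_filter.1 h').1
  symm i j a h := by
    obtain ⟨h1, h2, h3⟩ := Finset.mem_filter.1 h
    refine Finset.mem_filter.2 ⟨lam.symm i j a h1, ?_, ?_⟩
    · simpa only [absv_opp] using h3
    · simpa only [absv_opp] using h2
  short i j a h k hik hkj b := by
    obtain ⟨h1, h2⟩ := lam.short i j a (Finset.mem_filter.1 h).1 k hik hkj b
    exact ⟨fun h => h1 (Finset.mem_filter.1 h).1, fun h => h2 (Finset.mem_filter.1 h).1⟩

/-- `λ = λ|_A ⊔ λ|_{Aᶜ}`: every arc of `λ` is an arc of one of the two restrictions. -/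
def DPartition.Splits (lam : DPartition n F) (A : Finset (Fin n)) : Prop :=
  ((lam.restrict A).arcs : Set (PM n × PM n × F)) ∪ (lam.restrict Aᶜ).arcs = lam.arcs

instance (lam : DPartition n F) : DecidablePred lam.Splits := Classical.decPred _

/-- The relabelling of arcs that is inverse to `st_A`. -/
def unstArc (A : Finset (Fin n)) (t : PM A.card × PM A.card × F) : PM n × PM n × F :=
  (unst A t.1, unst A t.2.1, t.2.2)

theorem unstArc_inj (A : Finset (Fin n)) : Function.Injective (unstArc (F := F) A) := by
  rintro ⟨i, j, a⟩ ⟨i', j', a'⟩ h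
  simp only [unstArc, Prod.mk.injEq, (unst_inj A).eq_iff] at h
  obtain ⟨rfl, rfl, rfl⟩ := h
  rfl

/-- The arcs of `[±|A|]` whose relabelling is an arc of `μ`. -/
def stArcs (mu : DPartition n F) (A : Finset (Fin n)) : Finset (PM A.card × PM A.card × F) :=
  mu.arcs.preimage (unstArc A) (unstArc_inj A).injOn

theorem mem_stArcs (mu : DPartition n F) (A : Finset (Fin n)) (i j : PM A.card) (a : F) :
    (i, j, a) ∈ stArcs mu A ↔ (unst A i, unst A j, a) ∈ mu.arcs :=
  Finset.mem_preimage

/-- The standardization `st_A(μ)` of a partition `μ` with all arcs in `±A`: the ends of the arcs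
are relabelled by the order preserving bijection from `±A` to `[±|A|]`. -/
def DPartition.st (mu : DPartition n F) (A : Finset (Fin n)) : DPartition A.card F where
  arcs := stArcs mu A
  lt i j a h := (unst_lt A i j).1 (mu.lt _ _ _ ((mem_stArcs _ _ _ _ _).1 h))
  ne_opp i j a h e := mu.ne_opp _ _ _ ((mem_stArcs _ _ _ _ _).1 h) (by rw [← unst_opp, ← e])
  ne_zero i j a h := mu.ne_zero _ _ _ ((mem_stArcs _ _ _ _ _).1 h)
  label i j a b h h' :=
    mu.label _ _ _ _ ((mem_stArcs _ _ _ _ _).1 h) ((mem_stArcs _ _ _ _ _).1 h')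
  symm i j a h := by
    have := mu.symm _ _ _ ((mem_stArcs _ _ _ _ _).1 h)
    rw [mem_stArcs]
    simpa only [unst_opp] using this
  short i j a h k hik hkj b := by
    rw [mem_stArcs, mem_stArcs]
    exact mu.short _ _ _ ((mem_stArcs _ _ _ _ _).1 h) (unst A k)
      ((unst_lt A _ _).2 hik) ((unst_lt A _ _).2 hkj) b

end coproduct
end TypeD

end

/-!
Every two-sided orbit `U y U` of the unipotent upper triangular group contains exactly one matrix
with at most one nonzero entry in every row and column; for the orbit of `y_λ` it is `y_λ`. The
block sum along `±A ⊔ ±Aᶜ` of two such normal forms is again a normal form. So, by uniqueness, a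
block sum `u ⊕ v` lies in the orbit of `y_λ` only if `y_λ` is itself the block sum of the normal
forms of `u` and `v`; this means that `λ` splits along `(A | Aᶜ)`, and that the two normal forms
are the matrices of its standardized restrictions. Hence `st_J⁻¹` pulls `K_λ` back to a product of
two superclasses if `λ` splits, and to the empty set otherwise.
-/

namespace TypeD

section BlockSum

variable {n : ℕ} {F : Type*} [Field F] (A : Finset (Fin n))
  {u u' : Matrix (PM A.card) (PM A.card) F} {v v' : Matrix (PM Aᶜ.card) (PM Aᶜ.card) F}

theorem absv_glue_mem_iff (i : PM A.card ⊕ PM Aᶜ.card) : absv (glue A i) ∈ A ↔ i.isLeft := by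
  rcases i with i | i
  · exact iff_of_true (absv_unst A i) rfl
  · exact iff_of_false (Finset.mem_compl.1 (absv_unst Aᶜ i)) Bool.false_ne_true

theorem eq_blk_iff {y : Matrix (PM n) (PM n) F} :
    y = blk A u v ↔ (∀ i j, y i j ≠ 0 → (absv i ∈ A ↔ absv j ∈ A)) ∧
      y.submatrix (unst A) (unst A) = u ∧ y.submatrix (unst Aᶜ) (unst Aᶜ) = v := by
  constructor
  · rintro rfl
    refine ⟨(glue A).surjective.forall₂.2 fun i j h => ?_,
      Matrix.ext fun i j => blk_apply A u v (Sum.inl i) (Sum.inl j),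
      Matrix.ext fun i j => blk_apply A u v (Sum.inr i) (Sum.inr j)⟩
    rw [absv_glue_mem_iff, absv_glue_mem_iff]
    rw [blk_apply] at h
    rcases i with i | i <;> rcases j with j | j <;> simp_all
  · rintro ⟨hsupp, rfl, rfl⟩
    refine Matrix.ext ((glue A).surjective.forall₂.2 fun i j => ?_)
    have hij := hsupp (glue A i) (glue A j)
    rw [absv_glue_mem_iff, absv_glue_mem_iff] at hij
    rw [blk_apply]
    rcases i with i | i <;> rcases j with j | j
    · rfl
    · simpa using hij
    · simpa using hij
    · rfl

theorem partial_blk (hu : Partial u) (hv : Partial v) : Partial (blk A u v) := by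
  simp only [Partial, (glue A).surjective.forall, blk_apply, (glue A).injective.eq_iff, Sum.forall,
    Matrix.fromBlocks_apply₁₁, Matrix.fromBlocks_apply₁₂, Matrix.fromBlocks_apply₂₁,
    Matrix.fromBlocks_apply₂₂, Matrix.zero_apply, ne_eq, not_true_eq_false, false_imp_iff,
    Sum.inl.injEq, Sum.inr.injEq, implies_true, and_true, true_and]
  exact ⟨⟨hu.1, hv.1⟩, hu.2, hv.2⟩

theorem blk_mem_orbit_blk (hu : u' ∈ orbit u) (hv : v' ∈ orbit v) :
    blk A u' v' ∈ orbit (blk A u v) := by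
  obtain ⟨g, hg, h, hh, rfl⟩ := hu
  obtain ⟨g', hg', h', hh', rfl⟩ := hv
  exact ⟨blk A g g', blk_uni A hg hg', blk A h h', blk_uni A hh hh', by rw [blk_mul, blk_mul]⟩

theorem blk_mem_orbit_iff {y : Matrix (PM n) (PM n) F} (hy : Partial y) :
    blk A u v ∈ orbit y ↔ ∃ y₁ y₂, y = blk A y₁ y₂ ∧ u ∈ orbit y₁ ∧ v ∈ orbit y₂ := by
  constructor
  · intro h
    obtain ⟨y₁, hy₁, partial₁⟩ := exists_partial u
    obtain ⟨y₂, hy₂, partial₂⟩ := exists_partial v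
    have hblk : blk A y₁ y₂ ∈ orbit y := orbit_trans h (blk_mem_orbit_blk A hy₁ hy₂)
    exact ⟨y₁, y₂, (partial_unique hy (partial_blk A partial₁ partial₂) hblk).symm,
      orbit_symm hy₁, orbit_symm hy₂⟩
  · rintro ⟨y₁, y₂, rfl, hu, hv⟩
    exact blk_mem_orbit_blk A hu hv

end BlockSum

namespace DPartition

variable {n : ℕ} {F : Type*} [Field F] (lam : DPartition n F) (A : Finset (Fin n))

theorem mat_apply_of_mem_arcs {i j : PM n} {a : F} (h : (i, j, a) ∈ lam.arcs) :
    lam.mat i j = a := by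
  rw [mat, Matrix.sum_apply, Finset.sum_eq_single_of_mem _ h]
  · exact Matrix.single_apply_same i j a
  · rintro ⟨r, s, b⟩ hb hne
    refine Matrix.single_apply_of_ne _ _ _ _ _ ?_
    rintro ⟨rfl, rfl⟩
    exact hne (by rw [lam.label _ _ _ _ hb h])

theorem exists_mem_arcs_of_mat_apply_ne_zero {i j : PM n} (h : lam.mat i j ≠ 0) :
    ∃ a, (i, j, a) ∈ lam.arcs := by
  rw [mat, Matrix.sum_apply] at h
  obtain ⟨⟨r, s, a⟩, hmem, hne⟩ := Finset.exists_ne_zero_of_sum_ne_zero h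
  obtain ⟨⟨rfl, rfl⟩, -⟩ := ite_ne_right_iff.1 (Matrix.single_apply r s a i j ▸ hne)
  exact ⟨a, hmem⟩

theorem mat_apply_ne_zero_iff {i j : PM n} : lam.mat i j ≠ 0 ↔ ∃ a, (i, j, a) ∈ lam.arcs := by
  refine ⟨lam.exists_mem_arcs_of_mat_apply_ne_zero, ?_⟩
  rintro ⟨a, h⟩
  exact lam.mat_apply_of_mem_arcs h ▸ lam.ne_zero i j a h

theorem mem_arcs_iff {i j : PM n} {a : F} : (i, j, a) ∈ lam.arcs ↔ a ≠ 0 ∧ lam.mat i j = a := by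
  refine ⟨fun h => ⟨lam.ne_zero i j a h, lam.mat_apply_of_mem_arcs h⟩, ?_⟩
  rintro ⟨h, rfl⟩
  obtain ⟨b, hb⟩ := lam.exists_mem_arcs_of_mat_apply_ne_zero h
  rwa [lam.mat_apply_of_mem_arcs hb]

theorem partial_mat : Partial lam.mat := by
  have right_le {i j k : PM n} {a b : F} (hj : (i, j, a) ∈ lam.arcs) (hk : (i, k, b) ∈ lam.arcs) :
      j ≤ k :=
    not_lt.1 fun hkj => (lam.short i j a hj k (lam.lt i k b hk) hkj b).1 hk
  have left_le {i j k : PM n} {a b : F} (hi : (i, k, a) ∈ lam.arcs) (hj : (j, k, b) ∈ lam.arcs) :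
      j ≤ i :=
    not_lt.1 fun hij => (lam.short i k a hi j hij (lam.lt j k b hj) b).2 hj
  simp only [Partial, mat_apply_ne_zero_iff]
  constructor
  · rintro i j k ⟨a, hj⟩ ⟨b, hk⟩
    exact (right_le hj hk).antisymm (right_le hk hj)
  · rintro i j k ⟨a, hi⟩ ⟨b, hj⟩
    exact (left_le hj hi).antisymm (left_le hi hj)

theorem mat_restrict_st :
    ((lam.restrict A).st A).mat = lam.mat.submatrix (unst A) (unst A) := by
  refine mat_of_partial _ _ fun i j a => ?_
  calc (i, j, a) ∈ ((lam.restrict A).st A).arcs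
      ↔ (unst A i, unst A j, a) ∈ (lam.restrict A).arcs := mem_stArcs _ A i j a
    _ ↔ (unst A i, unst A j, a) ∈ lam.arcs :=
      Finset.mem_filter.trans (and_iff_left ⟨absv_unst A i, absv_unst A j⟩)
    _ ↔ a ≠ 0 ∧ lam.mat (unst A i) (unst A j) = a := lam.mem_arcs_iff

theorem splits_iff_forall_mem_arcs : lam.Splits A ↔
    ∀ i j a, (i, j, a) ∈ lam.arcs → (absv i ∈ A ↔ absv j ∈ A) := by
  simp only [Splits, restrict, Set.ext_iff, Set.mem_union, Finset.mem_coe, Finset.mem_filter,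
    Finset.mem_compl, ← and_or_left, and_iff_left_iff_imp, ← iff_iff_and_or_not_and_not,
    Prod.forall]

theorem splits_iff_forall_mat_apply_ne_zero : lam.Splits A ↔
    ∀ i j, lam.mat i j ≠ 0 → (absv i ∈ A ↔ absv j ∈ A) := by
  simp only [splits_iff_forall_mem_arcs, mat_apply_ne_zero_iff, forall_exists_index]

theorem mat_eq_blk_iff {y₁ : Matrix (PM A.card) (PM A.card) F}
    {y₂ : Matrix (PM Aᶜ.card) (PM Aᶜ.card) F} :
    lam.mat = blk A y₁ y₂ ↔ lam.Splits A ∧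
      ((lam.restrict A).st A).mat = y₁ ∧ ((lam.restrict Aᶜ).st Aᶜ).mat = y₂ := by
  rw [eq_blk_iff, splits_iff_forall_mat_apply_ne_zero, mat_restrict_st, mat_restrict_st]

end DPartition

section Superclass

variable {n : ℕ} {F : Type*} [Field F] (lam : DPartition n F) (A : Finset (Fin n))

theorem stJ_symm_sub_one (p : UD A.card F × UD Aᶜ.card F) :
    (((stJ A F).symm p).1 : Matrix (PM n) (PM n) F) - 1 = blk A (p.1.1 - 1) (p.2.1 - 1) := by
  rw [stJ_symm_val, ← blk_one A, blk_sub]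

theorem stJ_symm_mem_superclass_iff (p : UD A.card F × UD Aᶜ.card F) :
    ((stJ A F).symm p).1 ∈ superclass lam ↔ lam.Splits A ∧
      p ∈ superclass ((lam.restrict A).st A) ×ˢ superclass ((lam.restrict Aᶜ).st Aᶜ) := by
  simp only [superclass, Set.mem_prod, Set.mem_ofPred_eq, stJ_symm_sub_one,
    blk_mem_orbit_iff A lam.partial_mat, lam.mat_eq_blk_iff, and_assoc, exists_and_left,
    exists_eq_left']

theorem coe_kappa : (kappa lam : UD n F → ℂ) = (superclass lam).indicator 1 := by
  ext x
  simp only [kappa, Set.indicator, Pi.one_apply]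

theorem coe_tensorHom_kappa_tmul_kappa {k l : ℕ} (mu : DPartition k F) (nu : DPartition l F) :
    (tensorHom k l F (kappa mu ⊗ₜ kappa nu) : UD k F × UD l F → ℂ) =
      (superclass mu ×ˢ superclass nu).indicator 1 := by
  ext p
  rw [tensorHom_tmul, coe_kappa, coe_kappa, ← Set.indicator_prod_one]

variable [NeZero (2 : F)]

theorem resProd_kappa : resProd A (kappa lam) = if lam.Splits A then
    tensorHom _ _ F (kappa ((lam.restrict A).st A) ⊗ₜ kappa ((lam.restrict Aᶜ).st Aᶜ)) else 0 := by
  refine Subtype.ext (funext fun p => ?_)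
  change (kappa lam : UD n F → ℂ) ((stJ A F).symm p).1 = _
  rw [coe_kappa]
  split_ifs with hsplit
  · rw [coe_tensorHom_kappa_tmul_kappa]
    refine Set.indicator_eq_indicator ?_ rfl
    rw [stJ_symm_mem_superclass_iff, and_iff_right hsplit]
  · exact Set.indicator_of_notMem
      (fun hp => hsplit ((stJ_symm_mem_superclass_iff lam A p).1 hp).1) _

variable [Finite F]

theorem res_kappa : res A (kappa lam) = if lam.Splits A then
    kappa ((lam.restrict A).st A) ⊗ₜ[ℂ] kappa ((lam.restrict Aᶜ).st Aᶜ) else 0 := by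
  refine (tensorEquiv A.card Aᶜ.card F).symm_apply_eq.2 ?_
  rw [resProd_kappa, apply_ite (tensorEquiv _ _ F), LinearEquiv.map_zero]
  rfl

theorem coproduct_incl (χ : SC n F) : coproduct F (incl n F χ) =
    ∑ A : Finset (Fin n), TensorProduct.map (incl A.card F) (incl Aᶜ.card F) (res A χ) := by
  rw [coproduct, incl, DirectSum.toModule_lof, LinearMap.sum_apply]
  rfl

end Superclass

end TypeD

theorem mainTheorem3 {F : Type*} [Field F] [Finite F] [NeZero (2 : F)] (n : ℕ)
    (lam : TypeD.DPartition n F) :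
    TypeD.coproduct F (TypeD.incl n F (TypeD.kappa lam)) =
      ∑ A : Finset (Fin n) with lam.Splits A,
        TypeD.incl A.card F (TypeD.kappa ((lam.restrict A).st A)) ⊗ₜ[ℂ]
          TypeD.incl Aᶜ.card F (TypeD.kappa ((lam.restrict Aᶜ).st Aᶜ)) := by
  rw [TypeD.coproduct_incl, Finset.sum_filter]
  refine Finset.sum_congr rfl fun A _ => ?_
  rw [TypeD.res_kappa]
  split_ifs
  · exact TensorProduct.map_tmul _ _ _ _
  · exact map_zero _
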